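/- Let $\mathbb{F}$ be $\mathbb{R}$ or $\mathbb{C}$. Pairwise disjoint finite sets $V_1,\dots,V_n\subset\mathbb{F}^d$ with union $V=V_1\cup\dots\cup V_n$ are said to form a $(\delta,n)$-MR configuration if for every $i$ and every $v\in V_i$ there are at least $\delta|V_i|$ points $u\in V_i\setminus\{v\}$ such that the ($\mathbb{F}$-)line through $v$ and $u$ contains a point of $V\setminus V_i$. Theorem. There is an absolute constant $C>0$ such that, for $\mathbb{F}=\mathbb{R}$ and for $\mathbb{F}=\mathbb{C}$, for all $d$, $n$, $\delta$ and every $(\delta,n)$-MR configuration $V_1,\dots,V_n\subset\mathbb{F}^d$, and for every $0<\epsilon<\delta$, $$\dim_{\mathbb{F}}\operatorname{aff}_{\mathbb{F}}(V_1\cup\dots\cup V_n)\;\le\;\frac{C}{\epsilon^2}\left(1+\frac{1}{\delta-\epsilon}\right)^{n},$$ where $\operatorname{aff}_{\mathbb{F}}(S)$ is the smallest affine $\mathbb{F}$-subspace containing $S$. -/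

import Mathlib

/-- The colour classes `V 0, …, V (n - 1)` are finite sets of points of a `K`-vector space `E`.
They form a `(δ, n)`-MR configuration if they are pairwise disjoint and, for each class `V i` and
each `v ∈ V i`, there are at least `δ * |V i|` points `u ∈ V i \ {v}` such that the `K`-line
through `v` and `u` contains a point of another colour, i.e. a point of `(⋃ j, V j) \ V i`. -/
structure IsMRConfiguration (K : Type*) {E : Type*} [Field K] [AddCommGroup E] [Module K E]
    (δ : ℝ) (n : ℕ) (V : Fin n → Finset E) : Prop where
  disjoint : ∀ i j : Fin n, i ≠ j → Disjoint (V i) (V j)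
  many_lines : ∀ i : Fin n, ∀ v ∈ V i,
    δ * ((V i).card : ℝ) ≤
      (Set.ncard {u : E | u ∈ V i ∧ u ≠ v ∧
        ∃ w ∈ (⋃ j, (V j : Set E)) \ (V i : Set E), w ∈ affineSpan K {v, u}} : ℝ)

/-- The dimension over `K` of the affine span of a set of points (`0` for the empty set). -/
noncomputable def adim (K : Type*) {E : Type*} [Field K] [AddCommGroup E] [Module K E]
    (S : Set E) : ℕ :=
  Module.finrank K (affineSpan K S).direction

/-!
The dimension is bounded by the rank method for design matrices. Suppose that finitely many
vectors satisfy sparse linear relations, each vector owning at least `k` relations in which it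
occurs, and no two vectors occurring together in more than `t` relations. Scale the relation
matrix so that all its columns have almost norm one (`exists_approx_scaling`). Its Gram matrix is
then close to the identity in Frobenius norm, hence has small corank, and the vectors span a space
of dimension at most `t / k` times their number (`finrank_span_mul_le_of_sparse_relations`).

The relations come from collinear triples. Take points `v`, `u` of one colour. If their line carries
at least three points of that colour, the third point is the reflection `2 * v - u` for a numbering
of these points modulo their number; if not, it is a point of another colour. In both cases two
points occur together in boundedly many triples, the decisive point of the second case being that a
line with just two points of the colour of `v` is determined, along with `u`, by `v` and any other
point on it.

The rank bound is good only when the number of points is comparable to the number of relations per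
point, so colours of very different sizes have to be separated. Order the remaining colours by
decreasing size and stop at the first colour, of size `s`, such that the smaller ones have at most
`(δ - ε) * s` points together (`exists_balanced_block`). Up to there the number of remaining points
shrinks at each step by at most the factor `M = 1 + 1 / (δ - ε)`, so that a block of `b` colours has
at most `2 * M ^ (b - 1) * s` points. Each of its points keeps `ε * s` partners whose line does not
need the smaller colours, and partners seen by a colour of an earlier block give relations modulo
the span `U` of the earlier blocks. Hence the block adds at most `32 / ε * M ^ (b - 1)` to the
dimension. As `M ≥ 2`, the contributions of all blocks sum to at most `32 / ε * M ^ n`.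
-/

/-! ### Matrix scaling -/

/-- Approximate matrix scaling. `X` is a nonnegative matrix with prescribed row sums `ρ` and
prescribed column sums one. Assigning every row `r` to a column `o r` with `X r (o r) > 0`, so that
each column receives rows of total weight one, guarantees that positive scalings of the rows and
columns meet the row sums exactly and the column sums up to any `η > 0`.

The scaling is read off from a minimiser of
`∑ r, ρ r * log (∑ c, X r c * exp (y c)) - ∑ c, y c`, which is bounded below but need not attain its
infimum; a small multiple of `∑ c, y c ^ 2` is added to force a minimiser, at the cost of `η`. -/
theorem exists_approx_scaling {R C : Type*} [Fintype R] [Fintype C] [DecidableEq C]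
    (X : R → C → ℝ) (hX : ∀ r c, 0 ≤ X r c) (o : R → C) (ho : ∀ r, 0 < X r (o r))
    (ρ : R → ℝ) (hρ : ∀ r, 0 < ρ r) (hcol : ∀ c, ∑ r with o r = c, ρ r = 1)
    {η : ℝ} (hη : 0 < η) :
    ∃ (a : R → ℝ) (b : C → ℝ), (∀ r, 0 < a r) ∧ (∀ c, 0 < b c) ∧
      (∀ r, ∑ c, a r * X r c * b c = ρ r) ∧
      ∀ c, |∑ r, a r * X r c * b c - 1| ≤ η := by
  set S : (C → ℝ) → R → ℝ := fun y r => ∑ c, X r c * Real.exp (y c) with hS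
  have hSge : ∀ y r, X r (o r) * Real.exp (y (o r)) ≤ S y r := fun y r =>
    Finset.single_le_sum (f := fun c => X r c * Real.exp (y c))
      (fun c _ => mul_nonneg (hX r c) (Real.exp_pos _).le) (Finset.mem_univ (o r))
  have hSpos : ∀ y r, 0 < S y r := fun y r =>
    (mul_pos (ho r) (Real.exp_pos _)).trans_le (hSge y r)
  set g : (C → ℝ) → ℝ := fun y => ∑ r, ρ r * Real.log (S y r) - ∑ c, y c with hg
  set m : ℝ := ∑ r, ρ r * Real.log (X r (o r)) with hm
  -- every column owns total weight one, so the linear term can be distributed over the rows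
  have hlin : ∀ y : C → ℝ, ∑ c, y c = ∑ r, ρ r * y (o r) := by
    intro y
    rw [← Finset.sum_fiberwise Finset.univ o (fun r => ρ r * y (o r))]
    refine Finset.sum_congr rfl fun c _ => ?_
    rw [Finset.sum_congr rfl (g := fun r => ρ r * y c)
      (fun r hr => by rw [(Finset.mem_filter.1 hr).2]), ← Finset.sum_mul, hcol, one_mul]
  have hgm : ∀ y, m ≤ g y := by
    intro y
    rw [hg, hm]
    simp only
    rw [hlin, ← Finset.sum_sub_distrib]
    refine Finset.sum_le_sum fun r _ => ?_
    rw [← mul_sub]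
    refine mul_le_mul_of_nonneg_left ?_ (hρ r).le
    have := Real.log_le_log (mul_pos (ho r) (Real.exp_pos _)) (hSge y r)
    rw [Real.log_mul (ho r).ne' (Real.exp_pos _).ne', Real.log_exp] at this
    linarith
  have hgc : Continuous g := by
    refine Continuous.sub (continuous_finsetSum _ fun r _ => continuous_const.mul ?_)
      (by fun_prop)
    exact Continuous.log (by fun_prop) fun y => (hSpos y r).ne'
  set B : ℝ := g 0 - m + 1 with hB
  have hBpos : 0 < B := by have := hgm 0; linarith
  set κ : ℝ := η ^ 2 / (4 * B) with hκ
  have hκpos : 0 < κ := by positivity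
  set h : (C → ℝ) → ℝ := fun y => g y + κ * ∑ c, y c ^ 2 with hh
  have hhc : Continuous h := by rw [hh]; fun_prop
  -- outside a large ball the regularised function exceeds its value at zero
  obtain ⟨y, hy⟩ : ∃ y, ∀ z, h y ≤ h z := by
    obtain ⟨y, -, hy⟩ := (isCompact_closedBall (0 : C → ℝ) (B / κ + 1)).exists_isMinOn
      ⟨0, by simp; positivity⟩ hhc.continuousOn
    refine ⟨y, fun z => ?_⟩
    by_cases hz : z ∈ Metric.closedBall (0 : C → ℝ) (B / κ + 1)
    · exact hy hz
    · have h0 : h y ≤ h 0 := hy (by simp; positivity)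
      refine h0.trans ?_
      have hz' : ∃ c, B / κ + 1 < |z c| := by
        by_contra! hcon
        refine hz ?_
        rw [mem_closedBall_zero_iff]
        exact (pi_norm_le_iff_of_nonneg (by positivity)).2 hcon
      obtain ⟨c, hc⟩ := hz'
      have h1 : z c ^ 2 ≤ ∑ c, z c ^ 2 :=
        Finset.single_le_sum (f := fun c => z c ^ 2) (fun c _ => sq_nonneg _) (Finset.mem_univ c)
      have hq : 0 < B / κ := by positivity
      have h2 : B / κ ≤ z c ^ 2 := by rw [← sq_abs]; nlinarith
      have h3 : B ≤ κ * ∑ c, z c ^ 2 := by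
        calc B = κ * (B / κ) := by field_simp
          _ ≤ _ := mul_le_mul_of_nonneg_left (h2.trans h1) hκpos.le
      have := hgm z
      simp only [hh, Pi.zero_apply]
      simp
      linarith
  have hybd : κ * ∑ c, y c ^ 2 ≤ B := by
    have h0 := hy 0
    have := hgm y
    simp only [hh, Pi.zero_apply] at h0
    simp at h0
    linarith
  refine ⟨fun r => ρ r / S y r, fun c => Real.exp (y c), fun r => div_pos (hρ r) (hSpos y r),
    fun c => Real.exp_pos _, fun r => ?_, fun c => ?_⟩
  · simp only [mul_assoc]
    rw [← Finset.mul_sum]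
    exact div_mul_cancel₀ _ (hSpos y r).ne'
  · -- the partial derivative in direction `c` vanishes at the minimiser
    have hu : ∀ c', HasDerivAt (fun s : ℝ => (y + s • Pi.single c 1 : C → ℝ) c')
        ((Pi.single c 1 : C → ℝ) c') 0 := by
      intro c'
      simpa using ((hasDerivAt_id (0 : ℝ)).mul_const ((Pi.single c 1 : C → ℝ) c')).const_add (y c')
    have hz0 : (y + (0 : ℝ) • Pi.single c 1 : C → ℝ) = y := by simp
    have hder : HasDerivAt (fun s : ℝ => h (y + s • Pi.single c 1))
        (∑ r, ρ r * ((∑ c', X r c' * (Real.exp (y c') * (Pi.single c 1 : C → ℝ) c')) / S y r)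
          - ∑ c', (Pi.single c 1 : C → ℝ) c'
          + κ * ∑ c', 2 * y c' * (Pi.single c 1 : C → ℝ) c') 0 := by
      refine HasDerivAt.add (HasDerivAt.sub (HasDerivAt.fun_sum fun r _ => ?_)
        (HasDerivAt.fun_sum fun c' _ => hu c'))
        (HasDerivAt.const_mul _ (HasDerivAt.fun_sum fun c' _ => ?_))
      · refine HasDerivAt.const_mul _ ?_
        have h1 : HasDerivAt (fun s : ℝ => S (y + s • Pi.single c 1) r)
            (∑ c', X r c' * (Real.exp (y c') * (Pi.single c 1 : C → ℝ) c')) 0 := by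
          refine HasDerivAt.fun_sum fun c' _ => HasDerivAt.const_mul _ ?_
          simpa using (hu c').exp
        have := h1.log (by rw [hz0]; exact (hSpos y r).ne')
        rwa [hz0] at this
      · have := (hu c').fun_pow 2
        simpa [mul_comm, mul_assoc, mul_left_comm] using this
    have hmin : IsLocalMin (fun s : ℝ => h (y + s • Pi.single c 1)) 0 :=
      Filter.Eventually.of_forall fun s => by simpa using hy (y + s • Pi.single c 1)
    have h0 := hmin.hasDerivAt_eq_zero hder
    simp only [Pi.single_apply, mul_ite, mul_one, mul_zero, Finset.sum_ite_eq',
      Finset.mem_univ, if_true] at h0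
    have h1 : ∑ r, ρ r / S y r * X r c * Real.exp (y c) - 1 = - (κ * (2 * y c)) := by
      have : ∑ r, ρ r / S y r * X r c * Real.exp (y c)
          = ∑ r, ρ r * (X r c * Real.exp (y c) / S y r) :=
        Finset.sum_congr rfl fun r _ => by ring
      rw [this]; linarith
    rw [h1, abs_neg]
    refine abs_le_of_sq_le_sq ?_ hη.le
    have h2 : y c ^ 2 ≤ ∑ c, y c ^ 2 :=
      Finset.single_le_sum (f := fun c => y c ^ 2) (fun c _ => sq_nonneg _) (Finset.mem_univ c)
    have h3 : κ * y c ^ 2 ≤ B := (mul_le_mul_of_nonneg_left h2 hκpos.le).trans hybd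
    calc (κ * (2 * y c)) ^ 2 = 4 * κ * (κ * y c ^ 2) := by ring
      _ ≤ 4 * κ * B := mul_le_mul_of_nonneg_left h3 (by positivity)
      _ = η ^ 2 := by rw [hκ]; field_simp

/-! ### The rank bound for sparse relations -/

open Matrix in
/-- The corank of a Hermitian matrix `H` is at most the squared Frobenius norm of `H - 1`: each zero
eigenvalue of `H` contributes one to `∑ i, (λ i - 1) ^ 2`. -/
theorem corank_le_sum_norm_sub_one_sq {K C : Type*} [RCLike K] [Fintype C] [DecidableEq C]
    {H : Matrix C C K} (hH : H.IsHermitian) :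
    (Fintype.card C : ℝ) ≤ H.rank + ∑ i, ∑ j, ‖(H - 1) i j‖ ^ 2 := by
  have hF : ((∑ i, ∑ j, ‖(H - 1) i j‖ ^ 2 : ℝ) : K) = ((H - 1)ᴴ * (H - 1)).trace := by
    rw [Matrix.trace, Finset.sum_comm]
    push_cast
    refine Finset.sum_congr rfl fun i _ => ?_
    simp only [Matrix.diag_apply, Matrix.mul_apply, Matrix.conjTranspose_apply]
    refine Finset.sum_congr rfl fun j _ => ?_
    rw [← RCLike.conj_mul]
    rfl
  have hE : ((H - 1)ᴴ * (H - 1)).trace = ((∑ i, (hH.eigenvalues i - 1) ^ 2 : ℝ) : K) := by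
    have h1 : (H - 1)ᴴ = H - 1 := (hH.sub Matrix.isHermitian_one)
    rw [h1]
    set φ := Unitary.conjStarAlgAut K (Matrix C C K) hH.eigenvectorUnitary with hφ
    set D : Matrix C C K := Matrix.diagonal (RCLike.ofReal ∘ hH.eigenvalues) with hD
    have h2 : H = φ D := hH.spectral_theorem
    have h3 : (H - 1) * (H - 1) = φ ((D - 1) * (D - 1)) := by
      rw [map_mul, map_sub, map_one, ← h2]
    rw [h3, hφ, Unitary.conjStarAlgAut_apply, Matrix.trace_mul_cycle, Unitary.coe_star_mul_self,
      one_mul, hD, ← Matrix.diagonal_one, Matrix.diagonal_sub, Matrix.diagonal_mul_diagonal,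
      Matrix.trace_diagonal]
    push_cast
    exact Finset.sum_congr rfl fun i _ => by simp [sq]
  have hS : ∑ i, ∑ j, ‖(H - 1) i j‖ ^ 2 = ∑ i, (hH.eigenvalues i - 1) ^ 2 := by
    have := hF.trans hE
    exact_mod_cast this
  rw [hS, hH.rank_eq_card_non_zero_eigs, Fintype.card_subtype, ← Finset.card_univ,
    Finset.card_eq_sum_ones, Finset.card_eq_sum_ones, Finset.sum_filter]
  push_cast
  rw [← Finset.sum_add_distrib]
  refine Finset.sum_le_sum fun i _ => ?_
  by_cases h : hH.eigenvalues i = 0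
  · simp [h]
  · simp [h, sq_nonneg]

/-- Vectors satisfying the linear relations given by the rows of `A` span a space of dimension at
most the corank of `A`. -/
theorem finrank_span_add_rank_le {K E R C : Type*} [Field K] [AddCommGroup E] [Module K E]
    [Fintype R] [Fintype C] (A : Matrix R C K) (x : C → E)
    (hrel : ∀ r, ∑ c, A r c • x c = 0) :
    Module.finrank K (Submodule.span K (Set.range x)) + A.rank ≤ Fintype.card C := by
  classical
  set Φ : (C → K) →ₗ[K] E := Fintype.linearCombination K x with hΦ
  have h1 : LinearMap.range Φ = Submodule.span K (Set.range x) :=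
    Fintype.range_linearCombination K x
  have h2 : Submodule.span K (Set.range A.row) ≤ LinearMap.ker Φ := by
    rw [Submodule.span_le]
    rintro _ ⟨r, rfl⟩
    simpa [hΦ, Fintype.linearCombination_apply] using hrel r
  have h3 := Φ.finrank_range_add_finrank_ker
  rw [Module.finrank_fintype_fun_eq_card, h1] at h3
  rw [A.rank_eq_finrank_span_row, ← h3]
  exact Nat.add_le_add_left (Submodule.finrank_mono h2) _

-- `ComplexOrder` supplies the star-ordered structure on `K` behind `rank (Aᴴ * A) = rank A`.
open scoped ComplexOrder in
/-- If vectors `x c` satisfy linear relations such that every vector owns at least `k` relations in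
which it really occurs, and any two vectors occur together in at most `t` relations, then the span
of the vectors has dimension at most `t / k` times their number.

After scaling, the columns of the relation matrix `A'` have norm almost one, and by the hypothesis
on pairs and Cauchy-Schwarz the off-diagonal part of the Gram matrix `A'ᴴ * A'` has small Frobenius
norm. So the Gram matrix is close to the identity and its corank is small. -/
theorem finrank_span_mul_le_of_sparse_relations {K E R C : Type*} [RCLike K] [AddCommGroup E]
    [Module K E] [Fintype R] [Fintype C] [DecidableEq C] (A : Matrix R C K) (x : C → E)
    (hrel : ∀ r, ∑ c, A r c • x c = 0) (o : R → C) (ho : ∀ r, A r (o r) ≠ 0)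
    {k : ℝ} (hk : 0 < k) (howner : ∀ c, k ≤ (Finset.univ.filter fun r => o r = c).card)
    (t : ℕ) (hpair : ∀ c c', c ≠ c' →
      (Finset.univ.filter fun r => A r c ≠ 0 ∧ A r c' ≠ 0).card ≤ t) :
    (Module.finrank K (Submodule.span K (Set.range x)) : ℝ) * k ≤ t * Fintype.card C := by
  set D : ℝ := (Module.finrank K (Submodule.span K (Set.range x)) : ℝ) with hD
  set N : ℝ := (Fintype.card C : ℝ) with hN
  set w : C → ℝ := fun c => ((Finset.univ.filter fun r => o r = c).card : ℝ) with hw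
  have hwpos : ∀ c, 0 < w c := fun c => hk.trans_le (howner c)
  set ρ : R → ℝ := fun r => (w (o r))⁻¹ with hρ
  have hρpos : ∀ r, 0 < ρ r := fun r => inv_pos.2 (hwpos _)
  have hρk : ∀ r, ρ r ≤ k⁻¹ := fun r => inv_anti₀ hk (howner _)
  have hcol : ∀ c, ∑ r with o r = c, ρ r = 1 := by
    intro c
    rw [Finset.sum_congr rfl (g := fun _ => (w c)⁻¹)
      (fun r hr => by simp only [hρ, (Finset.mem_filter.1 hr).2]), Finset.sum_const, nsmul_eq_mul]
    exact mul_inv_cancel₀ (hwpos c).ne'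
  have hρsum : ∑ r, ρ r = N := by
    rw [← Finset.sum_fiberwise Finset.univ o ρ, Finset.sum_congr rfl fun c _ => hcol c]
    simp [hN]
  -- the estimate obtained from a scaling with column sums within `η` of one
  have key : ∀ η : ℝ, 0 < η → D ≤ N * η ^ 2 + t * (N * k⁻¹) := by
    intro η hη
    obtain ⟨a, b, ha, hb, hrow, hcolη⟩ := exists_approx_scaling (fun r c => ‖A r c‖ ^ 2)
      (fun r c => sq_nonneg _) o (fun r => by have := norm_pos_iff.2 (ho r); positivity)
      ρ hρpos hcol hη
    set A' : Matrix R C K := fun r c => (Real.sqrt (a r) : K) * A r c * (Real.sqrt (b c) : K)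
      with hA'
    have hnorm : ∀ r c, ‖A' r c‖ ^ 2 = a r * ‖A r c‖ ^ 2 * b c := by
      intro r c
      simp only [hA', norm_mul, RCLike.norm_ofReal, abs_of_nonneg (Real.sqrt_nonneg _), mul_pow,
        Real.sq_sqrt (ha r).le, Real.sq_sqrt (hb c).le]
    set H : Matrix C C K := A'.conjTranspose * A' with hH
    have hHh : H.IsHermitian := Matrix.isHermitian_conjTranspose_mul_self A'
    have hrank : H.rank = A'.rank := Matrix.rank_conjTranspose_mul_self A'
    have hne : ∀ c, (Real.sqrt (b c) : K) ≠ 0 := fun c =>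
      RCLike.ofReal_ne_zero.2 (Real.sqrt_pos.2 (hb c)).ne'
    set x' : C → E := fun c => (Real.sqrt (b c) : K)⁻¹ • x c with hx'
    have hspan : Submodule.span K (Set.range x') = Submodule.span K (Set.range x) := by
      apply le_antisymm <;> rw [Submodule.span_le] <;> rintro _ ⟨c, rfl⟩
      · exact Submodule.smul_mem _ _ (Submodule.subset_span ⟨c, rfl⟩)
      · have : x c = (Real.sqrt (b c) : K) • x' c := by rw [hx', smul_inv_smul₀ (hne c)]
        rw [this]
        exact Submodule.smul_mem _ _ (Submodule.subset_span ⟨c, rfl⟩)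
    have hle := finrank_span_add_rank_le A' x' (fun r => by
      have : ∀ c, A' r c • x' c = (Real.sqrt (a r) : K) • A r c • x c := fun c => by
        rw [hA', hx', smul_smul, smul_smul, mul_assoc, mul_inv_cancel₀ (hne c), mul_one]
      rw [Finset.sum_congr rfl fun c _ => this c, ← Finset.smul_sum, hrel, smul_zero])
    have hle' : D + A'.rank ≤ N := by
      rw [hspan] at hle
      rw [hD, hN]
      exact_mod_cast hle
    have hcorank := corank_le_sum_norm_sub_one_sq hHh
    rw [hrank] at hcorank
    have hent : ∀ i j, ‖(H - 1) i j‖ ^ 2 ≤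
        (if i = j then η ^ 2 else 0) + t * ∑ r, ‖A' r i‖ ^ 2 * ‖A' r j‖ ^ 2 := by
      intro i j
      have hHij : H i j = ∑ r, star (A' r i) * A' r j := by
        simp [hH, Matrix.mul_apply]
      have hnn : 0 ≤ (t : ℝ) * ∑ r, ‖A' r i‖ ^ 2 * ‖A' r j‖ ^ 2 := by positivity
      by_cases hij : i = j
      · subst hij
        have : (H - 1) i i = ((∑ r, a r * ‖A r i‖ ^ 2 * b i - 1 : ℝ) : K) := by
          rw [Matrix.sub_apply, hHij, Matrix.one_apply_eq]
          push_cast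
          congr 1
          refine Finset.sum_congr rfl fun r _ => ?_
          rw [RCLike.star_def, RCLike.conj_mul, ← RCLike.ofReal_pow, hnorm]
          push_cast
          rfl
        rw [this, RCLike.norm_ofReal, if_pos rfl]
        have := pow_le_pow_left₀ (abs_nonneg _) (hcolη i) 2
        linarith
      · rw [if_neg hij, zero_add, Matrix.sub_apply, Matrix.one_apply_ne hij, sub_zero, hHij]
        set F := Finset.univ.filter fun r => A r i ≠ 0 ∧ A r j ≠ 0 with hF
        have h0 : ∀ r, r ∉ F → star (A' r i) * A' r j = 0 := by
          intro r hr
          by_cases h1 : A r i = 0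
          · simp [hA', h1]
          · have h2 : A r j = 0 := by
              by_contra h2
              exact hr (by simp [hF, h1, h2])
            simp [hA', h2]
        rw [← Finset.sum_subset (Finset.subset_univ F) fun r _ hr => h0 r hr]
        calc ‖∑ r ∈ F, star (A' r i) * A' r j‖ ^ 2
            ≤ (∑ r ∈ F, ‖star (A' r i) * A' r j‖) ^ 2 := by
              gcongr; exact norm_sum_le _ _
          _ ≤ F.card * ∑ r ∈ F, ‖star (A' r i) * A' r j‖ ^ 2 := sq_sum_le_card_mul_sum_sq
          _ ≤ t * ∑ r, ‖star (A' r i) * A' r j‖ ^ 2 := by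
              gcongr
              · exact hpair i j hij
              · exact Finset.subset_univ F
          _ = t * ∑ r, ‖A' r i‖ ^ 2 * ‖A' r j‖ ^ 2 := by
              simp [norm_mul, mul_pow]
    have hrow' : ∀ r, ∑ c, ‖A' r c‖ ^ 2 = ρ r := fun r => by
      rw [← hrow r]; exact Finset.sum_congr rfl fun c _ => hnorm r c
    have hdbl : ∑ i, ∑ j, ∑ r, ‖A' r i‖ ^ 2 * ‖A' r j‖ ^ 2 = ∑ r, ρ r ^ 2 := by
      simp_rw [← hrow', sq (∑ c, _), Finset.sum_mul_sum]
      rw [Finset.sum_comm' (t' := Finset.univ) (s' := fun _ => Finset.univ) (by simp)]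
      refine (Finset.sum_congr rfl fun j _ => Finset.sum_comm).trans ?_
      rw [Finset.sum_comm]
      exact Finset.sum_congr rfl fun r _ => Finset.sum_comm
    have hρ2 : ∑ r, ρ r ^ 2 ≤ N * k⁻¹ := by
      rw [← hρsum, Finset.sum_mul]
      refine Finset.sum_le_sum fun r _ => ?_
      rw [sq]
      exact mul_le_mul_of_nonneg_left (hρk r) (hρpos r).le
    have hsum : ∑ i, ∑ j, ‖(H - 1) i j‖ ^ 2 ≤ N * η ^ 2 + t * (N * k⁻¹) := by
      refine (Finset.sum_le_sum fun i _ => Finset.sum_le_sum fun j _ => hent i j).trans ?_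
      simp_rw [Finset.sum_add_distrib, ← Finset.mul_sum]
      rw [hdbl]
      have : ∑ i : C, ∑ j : C, (if i = j then η ^ 2 else 0) = N * η ^ 2 := by simp [hN]
      rw [this]
      gcongr
    linarith
  have hlim : D ≤ t * (N * k⁻¹) := by
    refine le_of_forall_pos_le_add fun e he => ?_
    have hN0 : 0 ≤ N := Nat.cast_nonneg _
    have hq : 0 < e / (N + 1) := by positivity
    have h1 := key (Real.sqrt (e / (N + 1))) (Real.sqrt_pos.2 hq)
    rw [Real.sq_sqrt hq.le] at h1
    have h2 : N * (e / (N + 1)) ≤ e := by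
      rw [mul_div_assoc', div_le_iff₀ (by linarith)]
      nlinarith
    linarith
  calc D * k ≤ t * (N * k⁻¹) * k := mul_le_mul_of_nonneg_right hlim hk.le
    _ = t * N := by field_simp

/-! ### Relations from collinear triples -/

theorem Submodule.finrank_sup_le_finrank_add_finrank_map_mkQ {K E : Type*} [Field K]
    [AddCommGroup E] [Module K E] [FiniteDimensional K E] (U W : Submodule K E) :
    Module.finrank K ↥(U ⊔ W) ≤ Module.finrank K U + Module.finrank K (W.map U.mkQ) := by
  have h1 := (U.mkQ.domRestrict (U ⊔ W)).finrank_range_add_finrank_ker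
  have h2 : LinearMap.range (U.mkQ.domRestrict (U ⊔ W)) = W.map U.mkQ := by
    rw [LinearMap.range_domRestrict, Submodule.map_sup, Submodule.mkQ_map_self, bot_sup_eq]
  have h3 : Module.finrank K (LinearMap.ker (U.mkQ.domRestrict (U ⊔ W))) ≤ Module.finrank K U := by
    rw [LinearMap.ker_domRestrict, Submodule.ker_mkQ]
    exact (Submodule.comapSubtypeEquivOfLe le_sup_left).finrank_eq.le
  rw [h2] at h1
  omega

/-- Let every pair `(v, u) ∈ R` of points of `C` come with a third point `z v u` on the line
through `v` and `u` which lies in `C` or in the subspace `U`. If every `v ∈ C` is the first entry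
of at least `k` pairs, if `v` and `z v u` determine `u`, and if `u` and `z v u` leave at most two
choices for `v`, then `C` spans a space of dimension at most `8 * |C| / k` modulo `U`.

Each pair gives an affine relation between three points, which is a relation between the points of
`C` modulo `U`. Two given points occur together in at most `1 + 1 + 1 + 1 + 2 + 2 = 8` of them,
according to which of the roles `v`, `u`, `z v u` they take. -/
theorem finrank_map_mkQ_span_mul_le {K E : Type*} [RCLike K] [AddCommGroup E] [Module K E]
    [DecidableEq E] (U : Submodule K E) (C : Finset E) (R : Finset (E × E)) (z : E → E → E)
    (hRC : ∀ v u, (v, u) ∈ R → v ∈ C ∧ u ∈ C)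
    (hne : ∀ v u, (v, u) ∈ R → v ≠ u ∧ z v u ≠ v ∧ z v u ≠ u)
    (hline : ∀ v u, (v, u) ∈ R → z v u ∈ affineSpan K {v, u})
    (hz : ∀ v u, (v, u) ∈ R → z v u ∈ C ∨ z v u ∈ U)
    (hright : ∀ p ∈ C, ∀ q ∈ C, (C.filter fun u => (p, u) ∈ R ∧ z p u = q).card ≤ 1)
    (hleft : ∀ p ∈ C, ∀ q ∈ C, (C.filter fun v => (v, p) ∈ R ∧ z v p = q).card ≤ 2)
    {k : ℝ} (hk : 0 < k) (howner : ∀ v ∈ C, k ≤ (C.filter fun u => (v, u) ∈ R).card) :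
    (Module.finrank K ((Submodule.span K (C : Set E)).map U.mkQ) : ℝ) * k ≤ 8 * C.card := by
  have hs : ∀ r : R, ∃ s : K, AffineMap.lineMap r.1.1 r.1.2 s = z r.1.1 r.1.2 := fun r =>
    mem_affineSpan_pair_iff_exists_lineMap_eq.1 (hline r.1.1 r.1.2 r.2)
  choose s hs using hs
  let A : Matrix R C K := fun r c => (if (c : E) = r.1.1 then 1 - s r else 0) +
    (if (c : E) = r.1.2 then s r else 0) + (if (c : E) = z r.1.1 r.1.2 then -1 else 0)
  have hs1 : ∀ r, 1 - s r ≠ 0 := by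
    intro r h
    have h1 : s r = 1 := by linear_combination -h
    have := hs r
    rw [h1, AffineMap.lineMap_apply_one] at this
    exact (hne _ _ r.2).2.2 this.symm
  have hrow : ∀ r c, A r c ≠ 0 → (c : E) = r.1.1 ∨ (c : E) = r.1.2 ∨ (c : E) = z r.1.1 r.1.2 := by
    intro r c h
    by_contra! hcon
    exact h (by simp [A, hcon.1, hcon.2.1, hcon.2.2])
  have hsingle : ∀ (p : E) (b : K), p ∈ C →
      ∑ c : C, (if (c : E) = p then b else 0) • U.mkQ (c : E) = b • U.mkQ p := by
    intro p b hp
    rw [Finset.sum_eq_single (⟨p, hp⟩ : C)]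
    · simp
    · intro c _ hc
      rw [if_neg (fun h => hc (Subtype.ext h)), zero_smul]
    · simp
  -- if the third point is not in `C`, then it vanishes modulo `U`
  have hthird : ∀ r : R, ∑ c : C, (if (c : E) = z r.1.1 r.1.2 then (-1 : K) else 0) • U.mkQ (c : E)
      = (-1 : K) • U.mkQ (z r.1.1 r.1.2) := by
    intro r
    by_cases h : z r.1.1 r.1.2 ∈ C
    · exact hsingle _ _ h
    · have h1 : U.mkQ (z r.1.1 r.1.2) = 0 := by
        rw [Submodule.mkQ_apply, Submodule.Quotient.mk_eq_zero]
        exact (hz _ _ r.2).resolve_left h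
      rw [h1, smul_zero]
      refine Finset.sum_eq_zero fun c _ => ?_
      rw [if_neg (fun hc => h (by rw [← hc]; exact c.2)), zero_smul]
  have hrel : ∀ r, ∑ c, A r c • U.mkQ (c : E) = 0 := by
    intro r
    simp only [A, add_smul, Finset.sum_add_distrib]
    rw [hsingle _ _ (hRC _ _ r.2).1, hsingle _ _ (hRC _ _ r.2).2, hthird, ← hs r,
      AffineMap.lineMap_apply_module, map_add, map_smul, map_smul]
    simp
    abel
  have hmain := finrank_span_mul_le_of_sparse_relations A (fun c : C => U.mkQ (c : E)) hrel
    (fun r => ⟨r.1.1, (hRC _ _ r.2).1⟩) (fun r => by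
      obtain ⟨h1, h2, -⟩ := hne _ _ r.2
      simp [A, h1, h2.symm, hs1 r]) hk (fun c => (howner c c.2).trans (by
        norm_cast
        refine Finset.card_le_card_of_surjOn (fun r : R => r.1.2) ?_
        intro u hu
        simp only [Finset.coe_filter, Set.mem_ofPred_eq] at hu
        exact ⟨⟨(c, u), hu.2⟩, by simp, rfl⟩)) 8 ?_
  · have himg : (Submodule.span K (C : Set E)).map U.mkQ
        = Submodule.span K (Set.range fun c : C => U.mkQ (c : E)) := by
      rw [Submodule.map_span]
      congr 1
      ext y
      simp
    rw [himg]
    simpa using hmain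
  · intro c c' hcc
    let F1 : E → E → Finset (E × E) := fun p q =>
      (C.filter fun u => (p, u) ∈ R ∧ z p u = q).image fun u => (p, u)
    let F2 : E → E → Finset (E × E) := fun p q =>
      (C.filter fun v => (v, p) ∈ R ∧ z v p = q).image fun v => (v, p)
    have hF1 : ∀ p q : C, (F1 p q).card ≤ 1 := fun p q =>
      Finset.card_image_le.trans (hright p p.2 q q.2)
    have hF2 : ∀ p q : C, (F2 p q).card ≤ 2 := fun p q =>
      Finset.card_image_le.trans (hleft p p.2 q q.2)
    have hsub : ((Finset.univ.filter fun r => A r c ≠ 0 ∧ A r c' ≠ 0).image Subtype.val) ⊆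
        ({((c : E), (c' : E)), ((c' : E), (c : E))} : Finset (E × E)) ∪
          ((F1 c c' ∪ F1 c' c) ∪ (F2 c c' ∪ F2 c' c)) := by
      intro p hp
      obtain ⟨⟨⟨v, u⟩, hr⟩, hr', rfl⟩ := Finset.mem_image.1 hp
      obtain ⟨h1, h2⟩ := (Finset.mem_filter.1 hr').2
      have h1 := hrow _ _ h1
      have h2 := hrow _ _ h2
      have hcc' : (c : E) ≠ c' := fun h => hcc (Subtype.ext h)
      have hC := hRC _ _ hr
      simp only [F1, F2, Finset.mem_union, Finset.mem_insert, Finset.mem_singleton,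
        Finset.mem_image, Finset.mem_filter, Prod.mk.injEq] at h1 h2 ⊢
      rcases h1 with h1 | h1 | h1 <;> rcases h2 with h2 | h2 | h2
      · exact absurd (h1.trans h2.symm) hcc'
      · exact Or.inl (Or.inl ⟨h1.symm, h2.symm⟩)
      · exact Or.inr (Or.inl (Or.inl ⟨u, ⟨hC.2, h1 ▸ hr, by rw [h1, h2]⟩, h1, rfl⟩))
      · exact Or.inl (Or.inr ⟨h2.symm, h1.symm⟩)
      · exact absurd (h1.trans h2.symm) hcc'
      · exact Or.inr (Or.inr (Or.inl ⟨v, ⟨hC.1, h1 ▸ hr, by rw [h1, h2]⟩, rfl, h1⟩))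
      · exact Or.inr (Or.inl (Or.inr ⟨u, ⟨hC.2, h2 ▸ hr, by rw [h1, h2]⟩, h2, rfl⟩))
      · exact Or.inr (Or.inr (Or.inr ⟨v, ⟨hC.1, h2 ▸ hr, by rw [h1, h2]⟩, rfl, h2⟩))
      · exact absurd (h1.trans h2.symm) hcc'
    rw [← Finset.card_image_of_injective _ Subtype.val_injective]
    refine (Finset.card_le_card hsub).trans ?_
    have b0 := Finset.card_union_le ({((c : E), (c' : E)), ((c' : E), (c : E))} : Finset (E × E))
      ((F1 c c' ∪ F1 c' c) ∪ (F2 c c' ∪ F2 c' c))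
    have b1 := Finset.card_union_le (F1 c c' ∪ F1 c' c) (F2 c c' ∪ F2 c' c)
    have b2 := Finset.card_union_le (F1 c c') (F1 c' c)
    have b3 := Finset.card_union_le (F2 c c') (F2 c' c)
    have b4 := Finset.card_le_two (a := ((c : E), (c' : E))) (b := ((c' : E), (c : E)))
    have := hF1 c c'
    have := hF1 c' c
    have := hF2 c c'
    have := hF2 c' c
    omega

/-- On a finite set `L`, numbered by the integers modulo `a = |L|`, the operation
`T x y = 2 * x - y` has the listed properties: it is injective in `y`, it takes each value at most
twice as a function of `x`, and for given `x` it has at most one fixed point besides `x`.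
Hence the triples `{x, y, T x y}` with three distinct entries cover each pair of elements boundedly
often, while a positive proportion of the `y` give such a triple. -/
theorem exists_reflection_operation {α : Type*} [DecidableEq α] (L : Finset α) :
    ∃ T : α → α → α, (∀ x ∈ L, ∀ y ∈ L, T x y ∈ L) ∧
      (∀ x ∈ L, ∀ y ∈ L, ∀ y' ∈ L, T x y = T x y' → y = y') ∧
      (∀ y ∈ L, ∀ z ∈ L, (L.filter fun x => T x y = z).card ≤ 2) ∧
      (∀ x ∈ L, ∀ y ∈ L, T x y = x → y = x) ∧
      (∀ x ∈ L, ∀ y ∈ L, ∀ y' ∈ L, y ≠ x → y' ≠ x → T x y = y → T x y' = y' → y = y') := by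
  classical
  rcases L.eq_empty_or_nonempty with rfl | hne
  · exact ⟨fun x _ => x, by simp⟩
  set a := L.card with ha
  have hapos : 0 < a := hne.card_pos
  let e : L ≃ Fin a := L.equivFin
  -- `2 * i - j` modulo `a`, written without `%` to stay within linear arithmetic
  let f : ℕ → ℕ → ℕ := fun i j =>
    if 2 * i < j then 2 * i + a - j else if 2 * i - j < a then 2 * i - j else 2 * i - j - a
  have hf : ∀ i j, i < a → j < a → f i j < a := by
    intro i j hi hj
    simp only [f]
    split_ifs <;> omega
  let T' : L → L → L := fun x y => e.symm ⟨f (e x) (e y), hf _ _ (e x).2 (e y).2⟩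
  have hT' : ∀ x y, ((e (T' x y) : Fin a) : ℕ) = f (e x) (e y) := fun x y => by simp [T']
  have hval : ∀ x y : L, ((e x : Fin a) : ℕ) = e y → x = y := fun x y h =>
    e.injective (Fin.ext h)
  let T : α → α → α := fun x y => if h : x ∈ L ∧ y ∈ L then T' ⟨x, h.1⟩ ⟨y, h.2⟩ else x
  have hT : ∀ x (hx : x ∈ L) y (hy : y ∈ L), T x y = T' ⟨x, hx⟩ ⟨y, hy⟩ := fun x hx y hy => by
    simp [T, hx, hy]
  refine ⟨T, fun x hx y hy => ?_, fun x hx y hy y' hy' h => ?_, fun y hy z hz => ?_,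
    fun x hx y hy h => ?_, fun x hx y hy y' hy' hne hne' h h' => ?_⟩
  · rw [hT x hx y hy]; exact (T' _ _).2
  · rw [hT x hx y hy, hT x hx y' hy'] at h
    have h2 := congrArg (fun z => ((e z : Fin a) : ℕ)) (Subtype.ext h)
    simp only [hT', f] at h2
    have h3 := hval ⟨y, hy⟩ ⟨y', hy'⟩ (by
      have b1 := (e ⟨x, hx⟩).2
      have b2 := (e ⟨y, hy⟩).2
      have b3 := (e ⟨y', hy'⟩).2
      split_ifs at h2 <;> omega)
    exact congrArg Subtype.val h3
  · -- a solution `x` of `2 x = y + z` is determined by whether `2 x` exceeds `a`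
    have : (L.filter fun x => T x y = z).card ≤ (Finset.univ : Finset Bool).card := by
      refine Finset.card_le_card_of_injOn
        (fun x => if h : x ∈ L then decide (2 * ((e ⟨x, h⟩ : Fin a) : ℕ) < a) else true)
        (fun _ _ => Finset.mem_univ _) ?_
      intro x hx x' hx' hxx
      simp only [Finset.coe_filter, Set.mem_ofPred_eq] at hx hx'
      obtain ⟨hx, h⟩ := hx
      obtain ⟨hx', h'⟩ := hx'
      simp only [hx, hx', dif_pos, decide_eq_decide] at hxx
      rw [hT x hx y hy] at h
      rw [hT x' hx' y hy] at h'
      have h2 := congrArg (fun z => ((e z : Fin a) : ℕ)) (Subtype.ext (h.trans h'.symm))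
      simp only [hT', f] at h2
      have h3 := hval ⟨x, hx⟩ ⟨x', hx'⟩ (by
        have b1 := (e ⟨x, hx⟩).2
        have b2 := (e ⟨y, hy⟩).2
        have b3 := (e ⟨x', hx'⟩).2
        split_ifs at h2 <;> omega)
      exact congrArg Subtype.val h3
    simpa using this
  · rw [hT x hx y hy] at h
    have h2 := congrArg (fun z => ((e z : Fin a) : ℕ))
      (Subtype.ext (a2 := (⟨x, hx⟩ : L)) h)
    simp only [hT', f] at h2
    have h3 := hval ⟨y, hy⟩ ⟨x, hx⟩ (by
      have b1 := (e ⟨x, hx⟩).2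
      have b2 := (e ⟨y, hy⟩).2
      split_ifs at h2 <;> omega)
    exact congrArg Subtype.val h3
  · rw [hT x hx y hy] at h
    rw [hT x hx y' hy'] at h'
    have h2 := congrArg (fun z => ((e z : Fin a) : ℕ)) (Subtype.ext (a2 := (⟨y, hy⟩ : L)) h)
    have h2' := congrArg (fun z => ((e z : Fin a) : ℕ)) (Subtype.ext (a2 := (⟨y', hy'⟩ : L)) h')
    simp only [hT', f] at h2 h2'
    have n1 : ((e ⟨y, hy⟩ : Fin a) : ℕ) ≠ e ⟨x, hx⟩ := fun hh =>
      hne (congrArg Subtype.val (hval _ _ hh))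
    have n2 : ((e ⟨y', hy'⟩ : Fin a) : ℕ) ≠ e ⟨x, hx⟩ := fun hh =>
      hne' (congrArg Subtype.val (hval _ _ hh))
    have h3 := hval ⟨y, hy⟩ ⟨y', hy'⟩ (by
      have b1 := (e ⟨x, hx⟩).2
      have b2 := (e ⟨y, hy⟩).2
      have b3 := (e ⟨y', hy'⟩).2
      split_ifs at h2 h2' <;> omega)
    exact congrArg Subtype.val h3

/-! ### Third points on the lines of a coloured point set -/

section ThirdPoint

variable {E : Type*} {n : ℕ}

open Classical in
/-- A choice of operation `fun x y => 2 * x - y` on the finite set `L`, numbered by the integers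
modulo `|L|`; see `exists_reflection_operation`. -/
noncomputable def reflection {α : Type*} (L : Finset α) : α → α → α :=
  (exists_reflection_operation L).choose

open Classical in
/-- The union of the colour classes containing `v`; for pairwise disjoint classes this is the
class of `v`, or empty if `v` has no colour. -/
noncomputable def colourClass (V : Fin n → Finset E) (v : E) : Finset E :=
  (Finset.univ.filter fun j => v ∈ V j).biUnion V

variable {V : Fin n → Finset E} {v u p q : E}

theorem colourClass_eq (hV : ∀ i j, i ≠ j → Disjoint (V i) (V j)) {i : Fin n} (hv : v ∈ V i) :
    colourClass V v = V i := by
  classical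
  have : (Finset.univ.filter fun j => v ∈ V j) = {i} := by
    ext j
    simp only [Finset.mem_filter, Finset.mem_univ, true_and, Finset.mem_singleton]
    refine ⟨fun h => ?_, fun h => h ▸ hv⟩
    by_contra hji
    exact Finset.disjoint_left.1 (hV j i hji) h hv
  unfold colourClass
  rw [this, Finset.singleton_biUnion]

theorem mem_colourClass_iff : u ∈ colourClass V v ↔ ∃ j, v ∈ V j ∧ u ∈ V j := by
  simp [colourClass]

theorem colourClass_eq_of_mem (hV : ∀ i j, i ≠ j → Disjoint (V i) (V j))
    (h : u ∈ colourClass V v) : colourClass V u = colourClass V v := by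
  obtain ⟨j, hv, hu⟩ := mem_colourClass_iff.1 h
  rw [colourClass_eq hV hv, colourClass_eq hV hu]

theorem mem_colourClass_self (h : u ∈ colourClass V v) : v ∈ colourClass V v := by
  obtain ⟨j, hv, hu⟩ := mem_colourClass_iff.1 h
  exact mem_colourClass_iff.2 ⟨j, hv, hv⟩

variable {K : Type*} [Field K] [AddCommGroup E] [Module K E]

open Classical in
variable (K) in
/-- The points with the colour of `v` on the line through `v` and `u`. -/
noncomputable def colourLine (V : Fin n → Finset E) (v u : E) : Finset E :=
  (colourClass V v).filter fun w => w ∈ affineSpan K {v, u}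

open Classical in
variable (K) in
/-- The third point of the relation attached to the pair `(v, u)`. If the line through `v` and `u`
carries at least three points of the colour of `v`, it is the reflection of `u` in `v` among these
points. Otherwise it is a point of `S` of another colour on the line; if there is none, the value is
`v`, which `IsUsablePair` excludes. -/
noncomputable def thirdPoint (V : Fin n → Finset E) (S : Set E) (v u : E) : E :=
  if 3 ≤ (colourLine K V v u).card then reflection (colourLine K V v u) v u
  else if h : ∃ w ∈ S, w ∉ colourClass V v ∧ w ∈ affineSpan K {v, u} then h.choose else v

variable (K) in
/-- The pair `(v, u)` consists of distinct points of the same colour, and its third point is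
different from both, so that the three points satisfy an affine relation with nonzero
coefficients. -/
def IsUsablePair (V : Fin n → Finset E) (S : Set E) (v u : E) : Prop :=
  u ∈ colourClass V v ∧ u ≠ v ∧ thirdPoint K V S v u ≠ v ∧ thirdPoint K V S v u ≠ u

variable {S : Set E}

theorem mem_colourLine {w : E} :
    w ∈ colourLine K V v u ↔ w ∈ colourClass V v ∧ w ∈ affineSpan K {v, u} := by
  simp [colourLine]

theorem left_mem_colourLine (h : u ∈ colourClass V v) : v ∈ colourLine K V v u :=
  mem_colourLine.2 ⟨mem_colourClass_self h, left_mem_affineSpan_pair _ _ _⟩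

theorem right_mem_colourLine (h : u ∈ colourClass V v) : u ∈ colourLine K V v u :=
  mem_colourLine.2 ⟨h, right_mem_affineSpan_pair _ _ _⟩

theorem colourLine_eq_of_mem (h : q ∈ affineSpan K {p, u}) (hqp : q ≠ p) :
    colourLine K V p q = colourLine K V p u := by
  unfold colourLine
  rw [affineSpan_pair_eq_of_right_mem_of_ne h hqp]

theorem colourLine_comm (hV : ∀ i j, i ≠ j → Disjoint (V i) (V j)) (h : u ∈ colourClass V v) :
    colourLine K V v u = colourLine K V u v := by
  unfold colourLine
  rw [colourClass_eq_of_mem hV h, Set.pair_comm]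

/-- The third point of a usable pair has the colour of the pair if and only if the line carries at
least three points of that colour. -/
theorem IsUsablePair.cases (h : IsUsablePair K V S v u) :
    (3 ≤ (colourLine K V v u).card ∧ thirdPoint K V S v u ∈ colourClass V v ∧
      thirdPoint K V S v u ∈ affineSpan K {v, u} ∧
      reflection (colourLine K V v u) v u = thirdPoint K V S v u) ∨
    ((colourLine K V v u).card ≤ 2 ∧ thirdPoint K V S v u ∉ colourClass V v ∧
      thirdPoint K V S v u ∈ affineSpan K {v, u} ∧ thirdPoint K V S v u ∈ S) := by
  classical
  obtain ⟨hu, -, hz, -⟩ := h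
  by_cases h3 : 3 ≤ (colourLine K V v u).card
  · left
    have hzeq : thirdPoint K V S v u = reflection (colourLine K V v u) v u := by
      unfold thirdPoint; rw [if_pos h3]
    have hmem := (exists_reflection_operation (colourLine K V v u)).choose_spec.1 v
      (left_mem_colourLine hu) u (right_mem_colourLine hu)
    change reflection (colourLine K V v u) v u ∈ _ at hmem
    rw [← hzeq, mem_colourLine] at hmem
    exact ⟨h3, hmem.1, hmem.2, hzeq.symm⟩
  · right
    by_cases hw : ∃ w ∈ S, w ∉ colourClass V v ∧ w ∈ affineSpan K {v, u}
    · have hzeq : thirdPoint K V S v u = hw.choose := by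
        unfold thirdPoint; rw [if_neg h3, dif_pos hw]
      have hspec := hw.choose_spec
      rw [← hzeq] at hspec
      exact ⟨by omega, hspec.2.1, hspec.2.2, hspec.1⟩
    · exact absurd (by unfold thirdPoint; rw [if_neg h3, dif_neg hw]) hz

theorem IsUsablePair.thirdPoint_mem_affineSpan (h : IsUsablePair K V S v u) :
    thirdPoint K V S v u ∈ affineSpan K {v, u} := by
  rcases h.cases with h | h
  exacts [h.2.2.1, h.2.2.1]

/-- If the line through `v` and `u` carries no more than two points of their colour, these are `v`
and `u`. -/
theorem eq_of_card_colourLine_le_two {w : E} (h2 : (colourLine K V v u).card ≤ 2)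
    (hu : u ∈ colourLine K V v u) (hw : w ∈ colourLine K V v u) (huv : u ≠ v) (hwv : w ≠ v) :
    w = u := by
  classical
  by_contra hwu
  have hv : v ∈ colourLine K V v u := left_mem_colourLine (mem_colourLine.1 hu).1
  have hsub : ({v, u, w} : Finset E) ⊆ colourLine K V v u := by
    intro x hx
    simp only [Finset.mem_insert, Finset.mem_singleton] at hx
    rcases hx with rfl | rfl | rfl <;> assumption
  have h3 : ({v, u, w} : Finset E).card = 3 := by
    rw [Finset.card_eq_three]
    exact ⟨v, u, w, huv.symm, hwv.symm, fun h => hwu h.symm, rfl⟩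
  have := Finset.card_le_card hsub
  omega

/-- A usable pair is determined by its first entry and its third point. -/
theorem thirdPoint_right_injective {u' : E} (h : IsUsablePair K V S p u)
    (h' : IsUsablePair K V S p u') (heq : thirdPoint K V S p u = thirdPoint K V S p u') :
    u = u' := by
  classical
  have hL : colourLine K V p u = colourLine K V p u' := by
    rw [← colourLine_eq_of_mem h.thirdPoint_mem_affineSpan h.2.2.1,
      ← colourLine_eq_of_mem h'.thirdPoint_mem_affineSpan h'.2.2.1, heq]
  have hu := right_mem_colourLine (K := K) h.1
  have hu' := right_mem_colourLine (K := K) h'.1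
  have hp := left_mem_colourLine (K := K) h.1
  rw [← hL] at hu'
  rcases h.cases with hc | hc <;> rcases h'.cases with hc' | hc'
  · have h1 := hc'.2.2.2
    rw [← hL, ← heq] at h1
    exact (exists_reflection_operation (colourLine K V p u)).choose_spec.2.1 p hp u hu u' hu'
      (hc.2.2.2.trans h1.symm)
  · exact absurd (heq ▸ hc.2.1) hc'.2.1
  · exact absurd (heq ▸ hc'.2.1) hc.2.1
  · exact (eq_of_card_colourLine_le_two hc.1 hu hu' h.2.1 h'.2.1).symm

open Classical in
/-- At most two usable pairs share a given second entry and a given third point. -/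
theorem card_filter_thirdPoint_eq_le_two (hV : ∀ i j, i ≠ j → Disjoint (V i) (V j))
    (C : Finset E) (p q : E) :
    (C.filter fun v => IsUsablePair K V S v p ∧ thirdPoint K V S v p = q).card ≤ 2 := by
  rcases (C.filter fun v => IsUsablePair K V S v p ∧ thirdPoint K V S v p = q).eq_empty_or_nonempty
    with he | ⟨v0, hv0⟩
  · rw [he]; simp
  -- all solutions lie on the line through `p` and `q` and have the colour of `p`
  have hL : ∀ v, IsUsablePair K V S v p → thirdPoint K V S v p = q →
      colourLine K V v p = colourLine K V p q := by
    intro v h hq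
    rw [colourLine_comm hV h.1]
    refine (colourLine_eq_of_mem ?_ ?_).symm
    · rw [Set.pair_comm, ← hq]; exact h.thirdPoint_mem_affineSpan
    · rw [← hq]; exact h.2.2.2
  obtain ⟨h0, hq0⟩ := (Finset.mem_filter.1 hv0).2
  have hL0 := hL v0 h0 hq0
  by_cases h3 : 3 ≤ (colourLine K V p q).card
  · have hp : p ∈ colourLine K V p q := hL0 ▸ right_mem_colourLine h0.1
    have hq : q ∈ colourLine K V p q := by
      rcases h0.cases with hc | hc
      · rw [← hL0, ← hq0]; exact mem_colourLine.2 ⟨hc.2.1, hc.2.2.1⟩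
      · rw [hL0] at hc; omega
    refine (Finset.card_le_card ?_).trans
      ((exists_reflection_operation (colourLine K V p q)).choose_spec.2.2.1 p hp q hq)
    intro v hv
    obtain ⟨h, hvq⟩ := (Finset.mem_filter.1 hv).2
    have hLv := hL v h hvq
    refine Finset.mem_filter.2 ⟨hLv ▸ left_mem_colourLine h.1, ?_⟩
    rcases h.cases with hc | hc
    · rw [← hLv, ← hvq]; exact hc.2.2.2
    · rw [hLv] at hc; omega
  · refine (Finset.card_le_card (t := colourLine K V p q) ?_).trans (by omega)
    intro v hv
    obtain ⟨h, hvq⟩ := (Finset.mem_filter.1 hv).2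
    exact hL v h hvq ▸ left_mem_colourLine h.1

open Classical in
/-- Among the points `u` of the colour of `v` for which the line through `v` and `u` contains a
point of another colour lying in `S ∪ W`, at least half become usable partners of `v`, up to `|W|`
exceptions. The exceptions are those `u` whose line has two points of their colour and is seen
only by `W`; the factor two accounts for `u` fixed by the reflection in `v`. -/
theorem card_le_two_mul_card_usable_add (hV : ∀ i j, i ≠ j → Disjoint (V i) (V j)) {i : Fin n}
    (hv : v ∈ V i) (W : Finset E) (hWi : Disjoint W (V i)) :
    ((V i).filter fun u => u ≠ v ∧
        ∃ w, (w ∈ S ∨ w ∈ W) ∧ w ∉ V i ∧ w ∈ affineSpan K {v, u}).card ≤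
      2 * ((V i).filter fun u => IsUsablePair K V S v u).card + W.card := by
  have hcl := colourClass_eq hV hv
  have hrefl := fun u => (exists_reflection_operation (colourLine K V v u)).choose_spec
  -- `deg` and `rich`: lines with at least three points of the colour; `good` and `bad`: with two
  set deg := (V i).filter fun u => u ≠ v ∧ 3 ≤ (colourLine K V v u).card ∧
    reflection (colourLine K V v u) v u = u with hdeg
  set rich := (V i).filter fun u => u ≠ v ∧ 3 ≤ (colourLine K V v u).card ∧
    reflection (colourLine K V v u) v u ≠ u with hrich
  set good := (V i).filter fun u => u ≠ v ∧ (colourLine K V v u).card ≤ 2 ∧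
    ∃ w ∈ S, w ∉ V i ∧ w ∈ affineSpan K {v, u} with hgood
  set bad := (V i).filter fun u => u ≠ v ∧ (colourLine K V v u).card ≤ 2 ∧
    ∃ w ∈ W, w ∈ affineSpan K {v, u} with hbad
  have hcover : ((V i).filter fun u => u ≠ v ∧
        ∃ w, (w ∈ S ∨ w ∈ W) ∧ w ∉ V i ∧ w ∈ affineSpan K {v, u}) ⊆
      (deg ∪ rich) ∪ (good ∪ bad) := by
    intro u hu
    obtain ⟨hui, huv, w, hwSW, hwi, hwl⟩ := Finset.mem_filter.1 hu
    simp only [hdeg, hrich, hgood, hbad, Finset.mem_union, Finset.mem_filter]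
    by_cases h3 : 3 ≤ (colourLine K V v u).card
    · by_cases hd : reflection (colourLine K V v u) v u = u
      · exact Or.inl (Or.inl ⟨hui, huv, h3, hd⟩)
      · exact Or.inl (Or.inr ⟨hui, huv, h3, hd⟩)
    · rcases hwSW with hw | hw
      · exact Or.inr (Or.inl ⟨hui, huv, by omega, w, hw, hwi, hwl⟩)
      · exact Or.inr (Or.inr ⟨hui, huv, by omega, w, hw, hwl⟩)
  -- each line carries at most one degenerate point, and then also a nondegenerate one
  have hdr : deg.card ≤ rich.card := by
    have hex : ∀ u, ∃ x, u ∈ deg → x ∈ colourLine K V v u ∧ x ≠ v ∧ x ≠ u := by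
      intro u
      by_cases hu : u ∈ deg
      · obtain ⟨hui, huv, h3, hd⟩ := Finset.mem_filter.1 hu
        obtain ⟨x, hx, hx'⟩ := Finset.exists_mem_notMem_of_card_lt_card
          (s := {v, u}) (t := colourLine K V v u) (Finset.card_le_two.trans_lt h3)
        simp only [Finset.mem_insert, Finset.mem_singleton, not_or] at hx'
        exact ⟨x, fun _ => ⟨hx, hx'.1, hx'.2⟩⟩
      · exact ⟨v, fun h => absurd h hu⟩
    choose x hx using hex
    have hLx : ∀ u ∈ deg, colourLine K V v (x u) = colourLine K V v u := fun u hu =>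
      colourLine_eq_of_mem (mem_colourLine.1 (hx u hu).1).2 (hx u hu).2.1
    refine Finset.card_le_card_of_injOn x (fun u hu => ?_) (fun u hu u' hu' huu => ?_)
    · have hu : u ∈ deg := hu
      obtain ⟨hui, huv, h3, hd⟩ := Finset.mem_filter.1 hu
      have huc : u ∈ colourClass V v := hcl ▸ hui
      refine Finset.mem_coe.2 (Finset.mem_filter.2 ⟨hcl ▸ (mem_colourLine.1 (hx u hu).1).1,
        (hx u hu).2.1, by rwa [hLx u hu], fun hd' => (hx u hu).2.2 ?_⟩)
      rw [hLx u hu] at hd'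
      exact (hrefl u).2.2.2.2 v (left_mem_colourLine huc) _ (hx u hu).1 u
        (right_mem_colourLine huc) (hx u hu).2.1 huv hd' hd
    · have hu : u ∈ deg := hu
      have hu' : u' ∈ deg := hu'
      have hLL : colourLine K V v u' = colourLine K V v u := by
        rw [← hLx u hu, ← hLx u' hu', huu]
      obtain ⟨hui, huv, h3, hd⟩ := Finset.mem_filter.1 hu
      obtain ⟨hui', huv', h3', hd'⟩ := Finset.mem_filter.1 hu'
      have huc : u ∈ colourClass V v := hcl ▸ hui
      have huc' : u' ∈ colourClass V v := hcl ▸ hui'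
      rw [hLL] at hd'
      exact (hrefl u).2.2.2.2 v (left_mem_colourLine huc) _ (right_mem_colourLine huc) u'
        (hLL ▸ right_mem_colourLine huc') huv huv' hd hd'
  -- on a line with two points of the colour of `v`, a point of `W` determines the second one
  have hbW : bad.card ≤ W.card := by
    have hex : ∀ u, ∃ w, u ∈ bad → w ∈ W ∧ w ∈ affineSpan K {v, u} := by
      intro u
      by_cases hu : u ∈ bad
      · obtain ⟨-, -, -, w, hw, hwl⟩ := Finset.mem_filter.1 hu
        exact ⟨w, fun _ => ⟨hw, hwl⟩⟩
      · exact ⟨v, fun h => absurd h hu⟩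
    choose w hw using hex
    have hLw : ∀ u ∈ bad, colourLine K V v (w u) = colourLine K V v u := fun u hu =>
      colourLine_eq_of_mem (hw u hu).2
        (fun h => Finset.disjoint_left.1 hWi (hw u hu).1 (h ▸ hv))
    refine Finset.card_le_card_of_injOn w (fun u hu => (hw u hu).1) (fun u hu u' hu' huu => ?_)
    have hu : u ∈ bad := hu
    have hu' : u' ∈ bad := hu'
    have hLL : colourLine K V v u' = colourLine K V v u := by
      rw [← hLw u hu, ← hLw u' hu', huu]
    obtain ⟨hui, huv, h2, -⟩ := Finset.mem_filter.1 hu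
    obtain ⟨hui', huv', h2', -⟩ := Finset.mem_filter.1 hu'
    have huc : u ∈ colourClass V v := hcl ▸ hui
    have huc' : u' ∈ colourClass V v := hcl ▸ hui'
    exact (eq_of_card_colourLine_le_two h2 (right_mem_colourLine huc)
      (hLL ▸ right_mem_colourLine huc') huv huv').symm
  have hrg : rich.card + good.card ≤ ((V i).filter fun u => IsUsablePair K V S v u).card := by
    rw [← Finset.card_union_of_disjoint]
    · refine Finset.card_le_card fun u hu => ?_
      rcases Finset.mem_union.1 hu with hu | hu
      · obtain ⟨hui, huv, h3, hd⟩ := Finset.mem_filter.1 hu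
        have huc : u ∈ colourClass V v := hcl ▸ hui
        have hz : thirdPoint K V S v u = reflection (colourLine K V v u) v u := by
          unfold thirdPoint; rw [if_pos h3]
        refine Finset.mem_filter.2 ⟨hui, huc, huv, ?_, ?_⟩
        · rw [hz]
          exact fun h => huv ((hrefl u).2.2.2.1 v (left_mem_colourLine huc) u
            (right_mem_colourLine huc) h)
        · rwa [hz]
      · obtain ⟨hui, huv, h2, hw⟩ := Finset.mem_filter.1 hu
        have huc : u ∈ colourClass V v := hcl ▸ hui
        rw [← hcl] at hw
        have hz : thirdPoint K V S v u = hw.choose := by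
          unfold thirdPoint; rw [if_neg (by omega), dif_pos hw]
        have hzc : thirdPoint K V S v u ∉ colourClass V v := by
          rw [hz]; exact hw.choose_spec.2.1
        refine Finset.mem_filter.2 ⟨hui, huc, huv, fun h => hzc ?_, fun h => hzc ?_⟩
        · rw [h, hcl]; exact hv
        · rw [h]; exact huc
    · refine Finset.disjoint_left.2 fun u hu hu' => ?_
      have h1 := (Finset.mem_filter.1 hu).2.2.1
      have h2 := (Finset.mem_filter.1 hu').2.2.1
      omega
  have c1 := Finset.card_le_card hcover
  have c2 := Finset.card_union_le (deg ∪ rich) (good ∪ bad)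
  have c3 := Finset.card_union_le deg rich
  have c4 := Finset.card_union_le good bad
  omega

end ThirdPoint

/-! ### Blocks of colours of comparable size -/

/-- Splitting off the largest sizes. Given sizes `f j` for `j ∈ J`, not all zero, some set `B` of
indices with sizes at least `s` has the property that the sizes outside `B` add up to at most
`τ * s`, and that the total size is at most `2 * (1 + 1 / τ) ^ (|B| - 1) * s`.

Take the sizes in decreasing order until the remaining ones add up to at most `τ` times the last one
taken. Before that, each step takes a size less than `1 / τ` times what remains, so the total of
the remaining sizes shrinks by at most the factor `1 + 1 / τ`. -/
theorem exists_balanced_block {ι : Type*} [DecidableEq ι] (f : ι → ℝ) (hf : ∀ i, 0 ≤ f i)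
    {τ : ℝ} (hτ : 0 < τ) (hτ1 : τ ≤ 1) (J : Finset ι) (hJ : ∃ j ∈ J, f j ≠ 0) :
    ∃ B ⊆ J, B.Nonempty ∧ ∃ s : ℝ, 0 < s ∧ (∀ j ∈ B, s ≤ f j) ∧
      ∑ j ∈ J \ B, f j ≤ τ * s ∧ ∑ j ∈ J, f j ≤ 2 * (1 + 1 / τ) ^ (B.card - 1) * s := by
  induction J using Finset.strongInduction with
  | H J ih =>
  obtain ⟨j1, hj1, hfj1⟩ := hJ
  obtain ⟨j0, hj0, hmax⟩ := J.exists_max_image f ⟨j1, hj1⟩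
  have hpos : 0 < f j0 := lt_of_lt_of_le (lt_of_le_of_ne (hf j1) (Ne.symm hfj1)) (hmax j1 hj1)
  have hsum : ∑ j ∈ J, f j = f j0 + ∑ j ∈ J.erase j0, f j := (Finset.add_sum_erase J f hj0).symm
  by_cases hcase : ∑ j ∈ J.erase j0, f j ≤ τ * f j0
  · refine ⟨{j0}, by simpa using hj0, by simp, f j0, hpos, by simp, ?_, ?_⟩
    · rwa [Finset.sdiff_singleton_eq_erase]
    · simp only [Finset.card_singleton, Nat.sub_self, pow_zero]
      nlinarith
  · push Not at hcase
    obtain ⟨B, hBJ, hBne, s, hs, hBs, hrest, htot⟩ := ih (J.erase j0) (Finset.erase_ssubset hj0) (by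
      by_contra! hcon
      rw [Finset.sum_eq_zero hcon] at hcase
      nlinarith)
    have hj0B : j0 ∉ B := fun h => (Finset.mem_erase.1 (hBJ h)).1 rfl
    refine ⟨insert j0 B, Finset.insert_subset hj0 (hBJ.trans (Finset.erase_subset _ _)),
      Finset.insert_nonempty _ _, s, hs, ?_, ?_, ?_⟩
    · intro j hj
      rcases Finset.mem_insert.1 hj with rfl | hj
      · obtain ⟨b, hb⟩ := hBne
        exact (hBs b hb).trans (hmax b (Finset.mem_of_mem_erase (hBJ hb)))
      · exact hBs j hj
    · rwa [Finset.sdiff_insert, ← Finset.erase_sdiff_comm]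
    · rw [Finset.card_insert_of_notMem hj0B, Nat.add_sub_cancel, hsum]
      have hc : B.card = B.card - 1 + 1 := by have := hBne.card_pos; omega
      have h1 : f j0 ≤ 1 / τ * ∑ j ∈ J.erase j0, f j := by
        rw [one_div, ← div_eq_inv_mul, le_div_iff₀ hτ]; linarith
      have h2 : 0 ≤ 1 + 1 / τ := by positivity
      rw [hc, pow_succ]
      have := mul_le_mul_of_nonneg_left htot h2
      linarith

section Configuration

variable {K E : Type*} [RCLike K] [AddCommGroup E] [Module K E] {n : ℕ}

open Classical in
/-- Colours in `B` have at least `s` points, colours outside `J` lie in the subspace `U`, and the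
colours in `J \ B` have so few points that they account for at most `(δ - ε) * s` of the partners
of a point. The remaining `ε * s` partners of each point of a colour in `B` give relations modulo
`U` between the points of the colours in `B`, which bound the dimension of their span modulo `U`.
-/
theorem IsMRConfiguration.finrank_map_mkQ_span_mul_le {δ ε : ℝ} {V : Fin n → Finset E}
    (hV : IsMRConfiguration K δ n V) (hε : 0 < ε) {B J : Finset (Fin n)}
    (U : Submodule K E) (hU : ∀ j, j ∉ J → (V j : Set E) ⊆ U) {s : ℝ} (hs : 0 < s)
    (hBs : ∀ j ∈ B, s ≤ (V j).card) (hrest : ∑ j ∈ J \ B, ((V j).card : ℝ) ≤ (δ - ε) * s)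
    (hεδ : ε < δ) :
    (Module.finrank K
      ((Submodule.span K ((B.biUnion V : Finset E) : Set E)).map U.mkQ) : ℝ) * (ε * s / 2) ≤
      8 * ∑ j ∈ B, ((V j).card : ℝ) := by
  have hdisj := hV.disjoint
  set C : Finset E := B.biUnion V with hC
  set S : Set E := (C : Set E) ∪ (U : Set E) with hS
  set R : Finset (E × E) := (C ×ˢ C).filter fun p => IsUsablePair K V S p.1 p.2 with hR
  have hmemR : ∀ v u, (v, u) ∈ R ↔ (v ∈ C ∧ u ∈ C) ∧ IsUsablePair K V S v u := fun v u => by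
    simp [hR]
  have hclC : ∀ v ∈ C, ∀ u ∈ colourClass V v, u ∈ C := by
    intro v hv u hu
    obtain ⟨j, hj, hvj⟩ := Finset.mem_biUnion.1 hv
    rw [colourClass_eq hdisj hvj] at hu
    exact Finset.mem_biUnion.2 ⟨j, hj, hu⟩
  have hcard : (C.card : ℝ) = ∑ j ∈ B, ((V j).card : ℝ) := by
    rw [hC, Finset.card_biUnion fun i _ j _ hij => hdisj i j hij]
    push_cast; rfl
  rw [← hcard]
  refine _root_.finrank_map_mkQ_span_mul_le U C R (thirdPoint K V S)
    (fun v u h => ((hmemR v u).1 h).1)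
    (fun v u h => ?_) (fun v u h => ((hmemR v u).1 h).2.thirdPoint_mem_affineSpan)
    (fun v u h => ?_) (fun p _ q _ => ?_) (fun p _ q _ => ?_) (by positivity) (fun v hv => ?_)
  · have h := ((hmemR v u).1 h).2
    exact ⟨h.2.1.symm, h.2.2.1, h.2.2.2⟩
  · obtain ⟨⟨hv, -⟩, h⟩ := (hmemR v u).1 h
    rcases h.cases with hc | hc
    · exact Or.inl (hclC v hv _ hc.2.1)
    · exact hc.2.2.2
  · refine Finset.card_le_one.2 fun u hu u' hu' => ?_
    obtain ⟨-, hu, hz⟩ := Finset.mem_filter.1 hu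
    obtain ⟨-, hu', hz'⟩ := Finset.mem_filter.1 hu'
    exact thirdPoint_right_injective ((hmemR _ _).1 hu).2 ((hmemR _ _).1 hu').2
      (hz.trans hz'.symm)
  · refine (Finset.card_le_card fun v hv => ?_).trans
      (card_filter_thirdPoint_eq_le_two (K := K) (S := S) hdisj C p q)
    obtain ⟨hvC, hvR, hz⟩ := Finset.mem_filter.1 hv
    exact Finset.mem_filter.2 ⟨hvC, ((hmemR _ _).1 hvR).2, hz⟩
  · obtain ⟨i, hi, hvi⟩ := Finset.mem_biUnion.1 hv
    set W : Finset E := (J \ B).biUnion V with hW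
    have hWi : Disjoint W (V i) := by
      rw [hW, Finset.disjoint_biUnion_left]
      intro j hj
      exact hdisj j i fun h => (Finset.mem_sdiff.1 hj).2 (h ▸ hi)
    have hWcard : (W.card : ℝ) ≤ (δ - ε) * s := by
      rw [hW, Finset.card_biUnion fun i _ j _ hij => hdisj i j hij]
      push_cast
      exact hrest
    have hmany := hV.many_lines i v hvi
    have hsub : {u : E | u ∈ V i ∧ u ≠ v ∧
        ∃ w ∈ (⋃ j, (V j : Set E)) \ (V i : Set E), w ∈ affineSpan K {v, u}} ⊆
        (((V i).filter fun u => u ≠ v ∧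
          ∃ w, (w ∈ S ∨ w ∈ W) ∧ w ∉ V i ∧ w ∈ affineSpan K {v, u} : Finset E) : Set E) := by
      rintro u ⟨hui, huv, w, ⟨hw, hwi⟩, hwl⟩
      refine Finset.mem_coe.2 (Finset.mem_filter.2 ⟨hui, huv, w, ?_, hwi, hwl⟩)
      obtain ⟨j, hwj⟩ := Set.mem_iUnion.1 hw
      by_cases hjB : j ∈ B
      · exact Or.inl (Or.inl (Finset.mem_coe.2 (Finset.mem_biUnion.2 ⟨j, hjB, hwj⟩)))
      · by_cases hjJ : j ∈ J
        · exact Or.inr (Finset.mem_biUnion.2 ⟨j, Finset.mem_sdiff.2 ⟨hjJ, hjB⟩, hwj⟩)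
        · exact Or.inl (Or.inr (hU j hjJ hwj))
    have h1 := Set.ncard_le_ncard hsub (Finset.finite_toSet _)
    rw [Set.ncard_coe_finset] at h1
    have h2 := h1.trans (card_le_two_mul_card_usable_add (K := K) (S := S) hdisj hvi W hWi)
    have h3 : ((V i).filter fun u => IsUsablePair K V S v u).card ≤
        (C.filter fun u => (v, u) ∈ R).card := by
      refine Finset.card_le_card fun u hu => ?_
      obtain ⟨hui, hu⟩ := Finset.mem_filter.1 hu
      have huC : u ∈ C := Finset.mem_biUnion.2 ⟨i, hi, hui⟩
      exact Finset.mem_filter.2 ⟨huC, (hmemR v u).2 ⟨⟨hv, huC⟩, hu⟩⟩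
    have h4 : δ * ((V i).card : ℝ) ≤ 2 * ((C.filter fun u => (v, u) ∈ R).card : ℝ) + W.card := by
      refine hmany.trans ?_
      exact_mod_cast h2.trans (by omega)
    have h5 := hBs i hi
    have h6 : δ * s ≤ δ * ((V i).card : ℝ) := mul_le_mul_of_nonneg_left h5 (by linarith)
    nlinarith

theorem IsMRConfiguration.le_one_of_mem {δ : ℝ} {V : Fin n → Finset E}
    (hV : IsMRConfiguration K δ n V) {i : Fin n} {v : E} (hv : v ∈ V i) : δ ≤ 1 := by
  have h1 := hV.many_lines i v hv
  have h2 : Set.ncard {u : E | u ∈ V i ∧ u ≠ v ∧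
      ∃ w ∈ (⋃ j, (V j : Set E)) \ (V i : Set E), w ∈ affineSpan K {v, u}} ≤ (V i).card := by
    rw [← Set.ncard_coe_finset]
    exact Set.ncard_le_ncard (fun u hu => hu.1) (Finset.finite_toSet _)
  have h3 : (0 : ℝ) < (V i).card := by exact_mod_cast Finset.card_pos.2 ⟨v, hv⟩
  have h4 : δ * ((V i).card : ℝ) ≤ 1 * (V i).card := by
    rw [one_mul]; exact h1.trans (by exact_mod_cast h2)
  exact le_of_mul_le_mul_right h4 h3

variable [FiniteDimensional K E]

open Classical in
/-- The colours in `J` enlarge the span of the other colours by at most the stated dimension. The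
induction splits off from `J` the block of large colours given by `exists_balanced_block`. -/
theorem IsMRConfiguration.finrank_span_le_add {δ ε : ℝ} {V : Fin n → Finset E}
    (hV : IsMRConfiguration K δ n V) (hε : 0 < ε) (hεδ : ε < δ) (J : Finset (Fin n)) :
    (Module.finrank K (Submodule.span K ((Finset.univ.biUnion V : Finset E) : Set E)) : ℝ) ≤
      Module.finrank K (Submodule.span K ((Jᶜ.biUnion V : Finset E) : Set E)) +
        32 / ε * (1 + 1 / (δ - ε)) ^ J.card := by
  induction J using Finset.strongInduction with
  | H J ih =>
  have hτ : 0 < δ - ε := sub_pos.2 hεδ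
  set M : ℝ := 1 + 1 / (δ - ε) with hM
  have hM0 : 0 < M := by positivity
  by_cases hne : ∃ j ∈ J, ((V j).card : ℝ) ≠ 0
  · have hδ1 : δ ≤ 1 := by
      obtain ⟨j, -, hj⟩ := hne
      obtain ⟨v, hv⟩ := Finset.card_ne_zero.1 (Nat.cast_ne_zero.1 hj)
      exact hV.le_one_of_mem hv
    have hM2 : 2 ≤ M := by
      have : 1 ≤ 1 / (δ - ε) := by rw [le_div_iff₀ hτ]; linarith
      linarith
    obtain ⟨B, hBJ, hBne, s, hs, hBs, hrest, htot⟩ := exists_balanced_block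
      (fun j => ((V j).card : ℝ)) (fun j => Nat.cast_nonneg _) hτ (by linarith) J hne
    set U := Submodule.span K ((Jᶜ.biUnion V : Finset E) : Set E) with hU
    have hblock := hV.finrank_map_mkQ_span_mul_le hε (B := B) (J := J) U (fun j hj v hv =>
      Submodule.subset_span (Finset.mem_coe.2 (Finset.mem_biUnion.2
        ⟨j, Finset.mem_compl.2 hj, hv⟩))) hs hBs hrest hεδ
    have hBsum : ∑ j ∈ B, ((V j).card : ℝ) ≤ 2 * M ^ (B.card - 1) * s :=
      (Finset.sum_le_sum_of_subset_of_nonneg hBJ fun _ _ _ => Nat.cast_nonneg _).trans htot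
    have hdim : (Module.finrank K
        ((Submodule.span K ((B.biUnion V : Finset E) : Set E)).map U.mkQ) : ℝ) ≤
        32 / ε * M ^ (B.card - 1) := by
      have hpos : 0 < ε * s / 2 := by positivity
      refine le_of_mul_le_mul_right (hblock.trans ?_) hpos
      calc 8 * ∑ j ∈ B, ((V j).card : ℝ) ≤ 8 * (2 * M ^ (B.card - 1) * s) := by linarith
        _ = 32 / ε * M ^ (B.card - 1) * (ε * s / 2) := by field_simp; norm_num
    have hih := ih (J \ B) (Finset.sdiff_ssubset hBJ hBne)
    have hsup : Submodule.span K ((((J \ B)ᶜ).biUnion V : Finset E) : Set E) =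
        U ⊔ Submodule.span K ((B.biUnion V : Finset E) : Set E) := by
      rw [hU, ← Submodule.span_union, ← Finset.coe_union, ← Finset.union_biUnion]
      congr 3
      ext j
      simp only [Finset.mem_compl, Finset.mem_sdiff, Finset.mem_union]
      tauto
    have hsupdim := Submodule.finrank_sup_le_finrank_add_finrank_map_mkQ U
      (Submodule.span K ((B.biUnion V : Finset E) : Set E))
    rw [← hsup] at hsupdim
    have hsupdim' := (Nat.cast_le (α := ℝ)).2 hsupdim
    push_cast at hsupdim'
    have hB1 := hBne.card_pos
    have hBc := Finset.card_le_card hBJ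
    have hJB : (J \ B).card = J.card - B.card := Finset.card_sdiff_of_subset hBJ
    -- both exponents are at most `J.card - 1`, and `2 ≤ M`
    have hp1 : M ^ (B.card - 1) ≤ M ^ (J.card - 1) :=
      pow_le_pow_right₀ (by linarith) (by omega)
    have hp2 : M ^ (J \ B).card ≤ M ^ (J.card - 1) :=
      pow_le_pow_right₀ (by linarith) (by omega)
    have hp3 : M ^ J.card = M ^ (J.card - 1) * M := by
      rw [← pow_succ]; congr 1; omega
    have hp0 : 0 < M ^ (J.card - 1) := by positivity
    have hp : M ^ (B.card - 1) + M ^ (J \ B).card ≤ M ^ J.card := by rw [hp3]; nlinarith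
    have hfin := mul_le_mul_of_nonneg_left hp (show 0 ≤ 32 / ε by positivity)
    rw [mul_add] at hfin
    linarith
  · push Not at hne
    have hsame : (Finset.univ.biUnion V : Finset E) = Jᶜ.biUnion V := by
      ext v
      simp only [Finset.mem_biUnion, Finset.mem_univ, true_and, Finset.mem_compl]
      refine ⟨fun ⟨j, hv⟩ => ⟨j, fun hj => ?_, hv⟩, fun ⟨j, _, hv⟩ => ⟨j, hv⟩⟩
      have h0 := Nat.cast_eq_zero.1 (hne j hj)
      rw [Finset.card_eq_zero.1 h0] at hv
      simp at hv
    rw [hsame]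
    have : 0 ≤ 32 / ε * M ^ J.card := by positivity
    linarith

theorem adim_le_finrank_span (X : Set E) : adim K X ≤ Module.finrank K (Submodule.span K X) := by
  unfold adim
  rw [direction_affineSpan]
  refine Submodule.finrank_mono ?_
  rw [vectorSpan_def, Submodule.span_le]
  rintro _ ⟨x, hx, y, hy, rfl⟩
  exact Submodule.sub_mem _ (Submodule.subset_span hx) (Submodule.subset_span hy)

theorem IsMRConfiguration.adim_le {δ ε : ℝ} {V : Fin n → Finset E}
    (hV : IsMRConfiguration K δ n V) (hε : 0 < ε) (hεδ : ε < δ) :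
    (adim K (⋃ i, (V i : Set E)) : ℝ) ≤ 32 / ε ^ 2 * (1 + 1 / (δ - ε)) ^ n := by
  classical
  have hτ : 0 < δ - ε := sub_pos.2 hεδ
  have hunion : (⋃ i, (V i : Set E)) = ((Finset.univ.biUnion V : Finset E) : Set E) := by
    simp
  have hdim := Nat.cast_le (α := ℝ) |>.2 (adim_le_finrank_span (K := K) (⋃ i, (V i : Set E)))
  by_cases hne : ∃ i, ∃ v, v ∈ V i
  · obtain ⟨i, v, hv⟩ := hne
    have hδ1 := hV.le_one_of_mem hv
    have h1 := hV.finrank_span_le_add hε hεδ Finset.univ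
    rw [Finset.compl_univ, Finset.biUnion_empty, Finset.coe_empty, Submodule.span_empty,
      finrank_bot, Nat.cast_zero, zero_add, Finset.card_univ, Fintype.card_fin] at h1
    rw [← hunion] at h1
    refine (hdim.trans h1).trans (mul_le_mul_of_nonneg_right ?_ (by positivity))
    -- `ε < δ ≤ 1` gives `1 / ε ≤ 1 / ε ^ 2`
    exact div_le_div_of_nonneg_left (by norm_num) (pow_pos hε 2) (by nlinarith)
  · push Not at hne
    have h0 : (⋃ i, (V i : Set E)) = ∅ := by
      rw [Set.iUnion_eq_empty]
      exact fun i => Set.eq_empty_of_forall_notMem fun v hv => hne i v hv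
    rw [h0, Submodule.span_empty, finrank_bot, Nat.cast_zero] at hdim
    rw [h0]
    exact hdim.trans (by positivity)

end Configuration

theorem theorem2 :
    ∃ C : ℝ, 0 < C ∧
      (∀ (d n : ℕ) (δ ε : ℝ) (V : Fin n → Finset (Fin d → ℝ)),
        0 < ε → ε < δ → IsMRConfiguration ℝ δ n V →
          (adim ℝ (⋃ i, (V i : Set (Fin d → ℝ))) : ℝ) ≤
            C / ε ^ 2 * (1 + 1 / (δ - ε)) ^ n) ∧
      (∀ (d n : ℕ) (δ ε : ℝ) (V : Fin n → Finset (Fin d → ℂ)),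
        0 < ε → ε < δ → IsMRConfiguration ℂ δ n V →
          (adim ℂ (⋃ i, (V i : Set (Fin d → ℂ))) : ℝ) ≤
            C / ε ^ 2 * (1 + 1 / (δ - ε)) ^ n) :=
  ⟨32, by norm_num, fun _ _ _ _ _ hε hεδ hV => hV.adim_le hε hεδ,
    fun _ _ _ _ _ hε hεδ hV => hV.adim_le hε hεδ⟩
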